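/- Let $1<p<\infty$ and let $X$ be a complex Banach space with the symmetric approximation property: there are idempotents $\Pi_N\in L(X)$ $(N\ge 1)$ of finite rank with $\Pi_N\to I$ strongly on $X$ and $\Pi_N^*\to I^*$ strongly on $X^*$. Let $E=l^p(\mathbb Z,X)$. Let $(V_kx)_n=x_{n-k}$ be the shifts on $E$ $(k\in\mathbb Z)$, let $P_k$ $(k\ge 0)$ be the projection with $(P_kx)_j=x_j$ for $|j|\le k$ and $(P_kx)_j=0$ otherwise, let $P$ be the projection with $(Px)_j=x_j$ for $j\ge 0$ and $(Px)_j=0$ for $j<0$, and let $Q=I-P$. A band operator is an $A\in L(E)$ whose matrix $(A_{ij})_{i,j\in\mathbb Z}$, with entries in $L(X)$, satisfies $A_{ij}=0$ whenever $|i-j|\ge k$, for some $k$; a band-dominated operator is a limit in the operator norm of band operators. An operator $A_h\in L(E)$ is the limit operator of $A\in L(E)$ with respect to a sequence $h:\mathbb N\to\mathbb Z$ if $\|P_k(V_{-h(n)}AV_{h(n)}-A_h)\|\to 0$ and $\|(V_{-h(n)}AV_{h(n)}-A_h)P_k\|\to 0$ as $n\to\infty$ for every $k$. Let $\sigma_+(A)$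 (resp. $\sigma_-(A)$) be the set of all limit operators of $A$ with respect to sequences $h$ tending to $+\infty$ (resp. $-\infty$). The operator $A$ is rich if every sequence $h$ with $|h(n)|\to\infty$ has a subsequence $g$ for which the limit operator $A_g$ exists. Let $\mathcal C_E^{\$}$ be the set of all rich band-dominated operators on $E$ all of whose matrix entries are compact. For a Fredholm operator $T$ put $\mathrm{ind}\,T=\dim\ker T-\dim(E/\mathrm{im}\,T)$, and put $\mathrm{ind}_+A=\mathrm{ind}(PAP+Q)$ and $\mathrm{ind}_-A=\mathrm{ind}(P+QAQ)$. Say that the index formula holds for a Fredholm operator $A\in I+\mathcal C_E^{\$}$ if, for arbitrary $B_+\in\sigma_+(A)$ and $B_-\in\sigma_-(A)$, $$\mathrm{ind}_+B_+=\mathrm{ind}_+A,\qquad \mathrm{ind}_-B_-=\mathrm{ind}_-A,\qquad \mathrm{ind}\,A=\mathrm{ind}_+B_++\mathrm{ind}_-B_-.$$ Let $\mathcal F$ be a subset of the set of all Fredholm operators in $I+\mathcal C_E^{\$}$ that is dense in this set with respect to the operator norm. If the index formula holds for all operators in $\mathcal F$, then it holds for all Fredholm operators in $I+\mathcal C_E^{\$}$.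 (For every Fredholm operator $A\in I+\mathcal C_E^{\$}$, the operators $PAP+Q$, $P+QAQ$, and $PB_+P+Q$, $P+QB_-Q$ with $B_\pm\in\sigma_\pm(A)$ are Fredholm, so that all indices above are defined.) -/

import Mathlib

open Filter Topology
open scoped ENNReal

noncomputable section

namespace BandDominated

/-- The symmetric approximation property of a complex Banach space `X`: there are idempotents
`Π N` of finite rank such that `Π N → I` strongly on `X` and `(Π N)^* → I` strongly on the
dual space (the adjoint of `Π N` being `f ↦ f ∘ Π N`). -/
def HasSAP (X : Type*) [NormedAddCommGroup X] [NormedSpace ℂ X] : Prop :=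
  ∃ proj : ℕ → X →L[ℂ] X,
    (∀ N, IsIdempotentElem (proj N)) ∧
    (∀ N, FiniteDimensional ℂ (proj N).range) ∧
    (∀ x : X, Tendsto (fun N => proj N x) atTop (𝓝 x)) ∧
    (∀ f : StrongDual ℂ X, Tendsto (fun N => f.comp (proj N)) atTop (𝓝 f))

/-- The space `E = l^p(ℤ, X)`. -/
abbrev SeqSpace (X : Type*) [NormedAddCommGroup X] (p : ℝ≥0∞) : Type _ :=
  lp (fun _ : ℤ => X) p

/-- The Fredholm index `dim ker T - dim (E / im T)` (meaningful for Fredholm operators `T`). -/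
def fredholmIndex {E : Type*} [NormedAddCommGroup E] [NormedSpace ℂ E] (T : E →L[ℂ] E) : ℤ :=
  (Module.finrank ℂ T.ker : ℤ) - (Module.finrank ℂ (E ⧸ T.range) : ℤ)

/-- On a Banach space, an operator is Fredholm if and only if its kernel and its cokernel are
finite-dimensional. -/
theorem isFredholm_iff {E : Type*} [NormedAddCommGroup E] [NormedSpace ℂ E] [CompleteSpace E]
    (T : E →L[ℂ] E) :
    T.IsFredholm ↔ FiniteDimensional ℂ T.ker ∧ FiniteDimensional ℂ (E ⧸ T.range) := by
  refine ⟨fun h => ⟨h.finite_ker, h.finite_coker⟩, ?_⟩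
  rintro ⟨hk, hc⟩
  obtain ⟨E₁, hE₁, hcompl⟩ :=
    (Submodule.ClosedComplemented.of_finiteDimensional T.ker).exists_isClosed_isCompl
  obtain ⟨G, hG⟩ := Submodule.exists_isCompl T.range
  have hGfin : FiniteDimensional ℂ G :=
    (Submodule.quotientEquivOfIsCompl _ _ hG).finiteDimensional
  have : CompleteSpace E₁ := hE₁.completeSpace_coe
  have hker : (T.comp E₁.subtypeL).ker = ⊥ := by
    rw [LinearMap.ker_eq_bot']
    intro x hx
    have h1 : (x : E) ∈ T.ker := hx
    have := Submodule.disjoint_def.1 hcompl.disjoint _ h1 x.2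
    exact Subtype.ext this
  have hmem : ∀ y : E, ∃ x : E₁, T x = T y := by
    intro y
    obtain ⟨a, ha, b, hb, rfl⟩ :=
      Submodule.mem_sup.1 (hcompl.sup_eq_top ▸ Submodule.mem_top (x := y))
    refine ⟨⟨b, hb⟩, ?_⟩
    have : T a = 0 := ha
    simp [this]
  have hrange : (T.comp E₁.subtypeL).range = T.range := by
    ext z
    constructor
    · rintro ⟨x, rfl⟩
      exact ⟨x, rfl⟩
    · rintro ⟨y, rfl⟩
      obtain ⟨x, hx⟩ := hmem y
      exact ⟨x, hx⟩
  have hclosed : IsClosed (T.range : Set E) := by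
    rw [← hrange]
    exact ContinuousLinearMap.closed_complemented_range_of_isCompl_of_ker_eq_bot _ G
      (hrange ▸ hG) G.closed_of_finiteDimensional hker
  have : CompleteSpace T.range := hclosed.completeSpace_coe
  have : E₁.CoFG := (Submodule.quotientEquivOfIsCompl _ _ hcompl.symm).symm.finiteDimensional
  have : T.range.CoFG := hc
  have hmaps : Set.MapsTo T E₁ T.range := fun x _ => ⟨x, rfl⟩
  refine ContinuousLinearMap.IsFredholm.of_isInvertible_restrict hE₁ hclosed hmaps ?_
  refine ⟨ContinuousLinearEquiv.ofBijective (T.restrict hmaps) ?_ ?_, ?_⟩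
  · rw [LinearMap.ker_eq_bot']
    intro x hx
    have : (T.comp E₁.subtypeL) x = 0 := congrArg Subtype.val hx
    exact (LinearMap.ker_eq_bot'.1 hker) x this
  · rw [LinearMap.range_eq_top]
    rintro ⟨_, y, rfl⟩
    obtain ⟨x, hx⟩ := hmem y
    exact ⟨x, Subtype.ext hx⟩
  · ext x; rfl

theorem memℓp_shift {X : Type*} [NormedAddCommGroup X] {p : ℝ≥0∞} {x : ℤ → X} (hx : Memℓp x p) (k : ℤ) :
    Memℓp (fun n => x (n - k)) p := by
  have hinj : Function.Injective (fun n : ℤ => n - k) := sub_left_injective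
  rcases p.trichotomy with rfl | rfl | hp
  · rw [memℓp_zero_iff] at hx ⊢
    exact hx.preimage hinj.injOn
  · rw [memℓp_infty_iff] at hx ⊢
    refine hx.mono ?_
    rintro _ ⟨n, rfl⟩
    exact ⟨n - k, rfl⟩
  · rw [memℓp_gen_iff hp] at hx ⊢
    exact hx.comp_injective hinj

theorem norm_shift_le {X : Type*} [NormedAddCommGroup X] {p : ℝ≥0∞} [Fact (1 ≤ p)]
    (x : SeqSpace X p) (k : ℤ) :
    ‖(⟨fun n => x (n - k), memℓp_shift (lp.memℓp x) k⟩ : SeqSpace X p)‖ ≤ ‖x‖ := by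
  have h0 : p ≠ 0 := (zero_lt_one.trans_le (Fact.out : 1 ≤ p)).ne'
  rcases p.trichotomy with rfl | rfl | hp
  · exact absurd rfl h0
  · exact lp.norm_le_of_forall_le (norm_nonneg _) fun n => lp.norm_apply_le_norm h0 x (n - k)
  · refine lp.norm_le_of_tsum_le hp (norm_nonneg _) (le_of_eq ?_)
    rw [lp.norm_rpow_eq_tsum hp x]
    exact (Equiv.subRight k).tsum_eq (fun n => ‖x n‖ ^ p.toReal)

/-- The shift operator `(V_k x)_n = x_{n-k}`. -/
def shift (X : Type*) [NormedAddCommGroup X] [NormedSpace ℂ X] (p : ℝ≥0∞) [Fact (1 ≤ p)]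
    (k : ℤ) : SeqSpace X p →L[ℂ] SeqSpace X p :=
  LinearMap.mkContinuous
    { toFun := fun x => ⟨fun n => x (n - k), memℓp_shift (lp.memℓp x) k⟩
      map_add' := fun _ _ => rfl
      map_smul' := fun _ _ => rfl } 1
    (fun x => (norm_shift_le x k).trans_eq (one_mul _).symm)

open Classical in
/-- The coordinate projection that keeps the entries `x_k` with `k ∈ S` and replaces all the
other entries by `0`. -/
def coordProj (X : Type*) [NormedAddCommGroup X] [NormedSpace ℂ X] (p : ℝ≥0∞) [Fact (1 ≤ p)]
    (S : Set ℤ) : SeqSpace X p →L[ℂ] SeqSpace X p :=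
  LinearMap.mkContinuous
    { toFun := fun x => ⟨fun n => if n ∈ S then x n else 0,
        (lp.memℓp x).mono' fun n => by split_ifs <;> simp⟩
      map_add' := fun x y => by
        ext n
        change (if n ∈ S then x n + y n else 0) =
          (if n ∈ S then x n else 0) + (if n ∈ S then y n else 0)
        split_ifs <;> simp
      map_smul' := fun c x => by
        ext n
        change (if n ∈ S then c • x n else 0) = c • (if n ∈ S then x n else 0)
        split_ifs <;> simp } 1
    (fun x => by
      rw [one_mul]
      refine lp.norm_mono (zero_lt_one.trans_le (Fact.out : 1 ≤ p)).ne' fun n => ?_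
      change ‖if n ∈ S then x n else 0‖ ≤ ‖x n‖
      split_ifs <;> simp)

/-- The projection `P_n` onto the entries with index `|k| ≤ n`. -/
def finProj (X : Type*) [NormedAddCommGroup X] [NormedSpace ℂ X] (p : ℝ≥0∞) [Fact (1 ≤ p)]
    (n : ℕ) : SeqSpace X p →L[ℂ] SeqSpace X p :=
  coordProj X p {k : ℤ | |k| ≤ (n : ℤ)}

/-- The projection `P` onto the entries with index `k ≥ 0`. -/
def plusProj (X : Type*) [NormedAddCommGroup X] [NormedSpace ℂ X] (p : ℝ≥0∞) [Fact (1 ≤ p)] :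
    SeqSpace X p →L[ℂ] SeqSpace X p :=
  coordProj X p {k : ℤ | 0 ≤ k}

/-- The projection `Q = I - P`. -/
def minusProj (X : Type*) [NormedAddCommGroup X] [NormedSpace ℂ X] (p : ℝ≥0∞) [Fact (1 ≤ p)] :
    SeqSpace X p →L[ℂ] SeqSpace X p :=
  1 - plusProj X p

section Operators

variable {X : Type*} [NormedAddCommGroup X] [NormedSpace ℂ X] {p : ℝ≥0∞} [Fact (1 ≤ p)]

/-- The entry `A_{ij} ∈ L(X)` of the matrix representation of `A ∈ L(E)`. -/
def entry (A : SeqSpace X p →L[ℂ] SeqSpace X p) (i j : ℤ) : X →L[ℂ] X :=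
  (lp.evalCLM ℂ (fun _ : ℤ => X) p i).comp
    (A.comp (lp.singleContinuousLinearMap ℂ (fun _ : ℤ => X) p j))

/-- Band operators: `A_{ij} = 0` whenever `|i - j| ≥ k`, for some `k`. -/
def IsBand (A : SeqSpace X p →L[ℂ] SeqSpace X p) : Prop :=
  ∃ k : ℕ, ∀ i j : ℤ, (k : ℤ) ≤ |i - j| → entry A i j = 0

variable (X p) in
/-- Band-dominated operators: the operator norm closure of the band operators. -/
def bandDominated : Set (SeqSpace X p →L[ℂ] SeqSpace X p) :=
  closure {A | IsBand A}

/-- `B` is the limit operator of `A` with respect to the sequence `h`. -/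
def IsLimitOperator (A : SeqSpace X p →L[ℂ] SeqSpace X p) (h : ℕ → ℤ)
    (B : SeqSpace X p →L[ℂ] SeqSpace X p) : Prop :=
  ∀ k : ℕ,
    Tendsto (fun n => ‖finProj X p k * (shift X p (-h n) * A * shift X p (h n) - B)‖)
      atTop (𝓝 0) ∧
    Tendsto (fun n => ‖(shift X p (-h n) * A * shift X p (h n) - B) * finProj X p k‖)
      atTop (𝓝 0)

/-- Rich operators: every sequence `h` of integers with `|h(n)| → ∞` has a subsequence with
respect to which the limit operator exists. -/
def IsRich (A : SeqSpace X p →L[ℂ] SeqSpace X p) : Prop :=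
  ∀ h : ℕ → ℤ, Tendsto (fun n => |h n|) atTop atTop →
    ∃ φ : ℕ → ℕ, StrictMono φ ∧ ∃ B, IsLimitOperator A (h ∘ φ) B

variable (X p) in
/-- The set of the rich band-dominated operators all of whose matrix entries are compact. -/
def richCompactEntries : Set (SeqSpace X p →L[ℂ] SeqSpace X p) :=
  {K | K ∈ bandDominated X p ∧ (∀ i j : ℤ, IsCompactOperator (entry K i j)) ∧ IsRich K}

variable (X p) in
/-- The set of all Fredholm operators of the form `I + K` with `K` a rich band-dominated operator
with compact entries. -/
def fredholmOperators : Set (SeqSpace X p →L[ℂ] SeqSpace X p) :=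
  {A | A.IsFredholm ∧ ∃ K ∈ richCompactEntries X p, A = 1 + K}

/-- `σ_+(A)`: the limit operators of `A` with respect to sequences tending to `+∞`. -/
def sigmaPlus (A : SeqSpace X p →L[ℂ] SeqSpace X p) :
    Set (SeqSpace X p →L[ℂ] SeqSpace X p) :=
  {B | ∃ h : ℕ → ℤ, Tendsto h atTop atTop ∧ IsLimitOperator A h B}

/-- `σ_-(A)`: the limit operators of `A` with respect to sequences tending to `-∞`. -/
def sigmaMinus (A : SeqSpace X p →L[ℂ] SeqSpace X p) :
    Set (SeqSpace X p →L[ℂ] SeqSpace X p) :=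
  {B | ∃ h : ℕ → ℤ, Tendsto h atTop atBot ∧ IsLimitOperator A h B}

/-- The operator `P A P + Q`. -/
def plusPart (A : SeqSpace X p →L[ℂ] SeqSpace X p) : SeqSpace X p →L[ℂ] SeqSpace X p :=
  plusProj X p * A * plusProj X p + minusProj X p

/-- The operator `P + Q A Q`. -/
def minusPart (A : SeqSpace X p →L[ℂ] SeqSpace X p) : SeqSpace X p →L[ℂ] SeqSpace X p :=
  plusProj X p + minusProj X p * A * minusProj X p

/-- The plus-index of `A`. -/
def indPlus (A : SeqSpace X p →L[ℂ] SeqSpace X p) : ℤ := fredholmIndex (plusPart A)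

/-- The minus-index of `A`. -/
def indMinus (A : SeqSpace X p →L[ℂ] SeqSpace X p) : ℤ := fredholmIndex (minusPart A)

/-- The index formula for the operator `A`. -/
def IndexFormula (A : SeqSpace X p →L[ℂ] SeqSpace X p) : Prop :=
  ∀ Bp ∈ sigmaPlus A, ∀ Bm ∈ sigmaMinus A,
    (indPlus Bp = indPlus A ∧ indMinus Bm = indMinus A) ∧
    fredholmIndex A = indPlus Bp + indMinus Bm

/-- The indices that occur in the index formula for `A` are indices of Fredholm operators. -/
def IndicesDefined (A : SeqSpace X p →L[ℂ] SeqSpace X p) : Prop :=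
  (plusPart A).IsFredholm ∧ (minusPart A).IsFredholm ∧
    (∀ B ∈ sigmaPlus A, (plusPart B).IsFredholm) ∧
    (∀ B ∈ sigmaMinus A, (minusPart B).IsFredholm)

end Operators

end BandDominated

end

namespace BandDominated

section Fredholm

variable {E : Type*} [NormedAddCommGroup E] [NormedSpace ℂ E]

theorem isFredholm_iff_exists_quasiInverse {A : E →L[ℂ] E} :
    A.IsFredholm ↔ ∃ R : E →L[ℂ] E, (R * A - 1 : E →L[ℂ] E).toLinearMap.HasFiniteRange ∧
      (A * R - 1 : E →L[ℂ] E).toLinearMap.HasFiniteRange := by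
  rw [ContinuousLinearMap.isFredholm_iff_exists_isQuasiInverse]
  refine exists_congr fun R => and_congr ?_ ?_
  · exact LinearMap.FiniteRangeSetoid.equiv_iff_hasFiniteRange
  · exact LinearMap.FiniteRangeSetoid.equiv_iff_hasFiniteRange

theorem isFredholm_of_bijective [CompleteSpace E] {A : E →L[ℂ] E} (h : Function.Bijective A) :
    A.IsFredholm := by
  rw [isFredholm_iff]
  have h1 : A.ker = ⊥ := LinearMap.ker_eq_bot.2 h.1
  have h2 : A.range = ⊤ := LinearMap.range_eq_top.2 h.2
  rw [h1, h2]
  exact ⟨inferInstance, inferInstance⟩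

theorem isFredholm_of_mul [CompleteSpace E] {A R S : E →L[ℂ] E} (hR : (R * A).IsFredholm)
    (hS : (A * S).IsFredholm) : A.IsFredholm := by
  rw [isFredholm_iff] at *
  refine ⟨?_, ?_⟩
  · have := hR.1
    refine Submodule.finiteDimensional_of_le (S₂ := (R * A).ker) fun x hx => ?_
    have : A x = 0 := hx
    change R (A x) = 0
    rw [this, map_zero]
  · have := hS.2
    have hle : (A * S).range ≤ A.range := by
      rintro _ ⟨x, rfl⟩
      exact ⟨S x, rfl⟩
    exact Module.Finite.of_surjective (Submodule.factor hle) (Submodule.factor_surjective hle)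

theorem isFredholm_of_commute_mul [CompleteSpace E] {A B : E →L[ℂ] E} (h : Commute A B)
    (hAB : (A * B).IsFredholm) : A.IsFredholm ∧ B.IsFredholm :=
  ⟨isFredholm_of_mul (R := B) (S := B) (h.eq ▸ hAB) hAB,
    isFredholm_of_mul (R := A) (S := A) hAB (h.eq ▸ hAB)⟩

/-- The norm limits of operators of finite rank. -/
def approximable (E : Type*) [NormedAddCommGroup E] [NormedSpace ℂ E] : Set (E →L[ℂ] E) :=
  closure {T | T.toLinearMap.HasFiniteRange}

theorem approximable_add {S T : E →L[ℂ] E} (hS : S ∈ approximable E) (hT : T ∈ approximable E) :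
    S + T ∈ approximable E :=
  map_mem_closure₂ continuous_add hS hT fun _ hs _ ht => LinearMap.HasFiniteRange.add hs ht

theorem approximable_zero : (0 : E →L[ℂ] E) ∈ approximable E :=
  subset_closure LinearMap.HasFiniteRange.zero

theorem approximable_sum {ι : Type*} (s : Finset ι) {T : ι → E →L[ℂ] E}
    (hT : ∀ i ∈ s, T i ∈ approximable E) : ∑ i ∈ s, T i ∈ approximable E := by
  classical
  induction s using Finset.induction_on with
  | empty => simpa using approximable_zero
  | insert a s ha ih =>
    rw [Finset.sum_insert ha]
    exact approximable_add (hT _ (by simp)) (ih fun i hi => hT i (by simp [hi]))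

theorem approximable_comp {F : Type*} [NormedAddCommGroup F] [NormedSpace ℂ F]
    {T : E →L[ℂ] E} (hT : T ∈ approximable E) (L : E →L[ℂ] F) (R : F →L[ℂ] E) :
    L.comp (T.comp R) ∈ approximable F :=
  map_mem_closure (f := fun T : E →L[ℂ] E => L.comp (T.comp R)) (by fun_prop) hT
    fun _ ht => (LinearMap.HasFiniteRange.comp_right ht R.toLinearMap).comp_left L.toLinearMap

theorem isFredholm_one_add_of_approximable [CompleteSpace E] {T : E →L[ℂ] E}
    (hT : T ∈ approximable E) : (1 + T).IsFredholm := by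
  obtain ⟨F, hF, hFT⟩ := Metric.mem_closure_iff.1 hT 1 one_pos
  rw [dist_eq_norm] at hFT
  obtain ⟨u, hu⟩ : IsUnit (1 + (T - F)) := by
    have := isUnit_one_sub_of_norm_lt_one (x := -(T - F)) (by rwa [norm_neg])
    rwa [sub_neg_eq_add] at this
  have h1 : 1 + T = u + F := by rw [hu]; abel
  rw [isFredholm_iff_exists_quasiInverse]
  refine ⟨↑u⁻¹, ?_, ?_⟩
  · rw [h1, mul_add, Units.inv_mul, add_sub_cancel_left]
    exact LinearMap.HasFiniteRange.comp_left hF _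
  · rw [h1, add_mul, Units.mul_inv, add_sub_cancel_left]
    exact LinearMap.HasFiniteRange.comp_right hF _

theorem isFredholm_add_of_approximable [CompleteSpace E] {A T : E →L[ℂ] E} (hA : A.IsFredholm)
    (hT : T ∈ approximable E) : (A + T).IsFredholm := by
  obtain ⟨R, h1, h2⟩ := isFredholm_iff_exists_quasiInverse.1 hA
  refine isFredholm_of_mul (R := R) (S := R) ?_ ?_
  · have : R * (A + T) = 1 + ((R * A - 1) + R.comp (T.comp (1 : E →L[ℂ] E))) := by
      rw [mul_add]; change _ = 1 + ((R * A - 1) + R * T); abel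
    rw [this]
    exact isFredholm_one_add_of_approximable
      (approximable_add (subset_closure h1) (approximable_comp hT _ _))
  · have : (A + T) * R = 1 + ((A * R - 1) + ContinuousLinearMap.comp (1 : E →L[ℂ] E) (T.comp R)) := by
      rw [add_mul]; change _ = 1 + ((A * R - 1) + T * R); abel
    rw [this]
    exact isFredholm_one_add_of_approximable
      (approximable_add (subset_closure h2) (approximable_comp hT _ _))

/-- If the composition of `B` with an operator `q` with finite-dimensional kernel has the same
range as `q`, then this composition has the same index as `B`. -/
theorem fredholmIndex_of_range_comp_eq [CompleteSpace E] {B q : E →L[ℂ] E}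
    [FiniteDimensional ℂ q.ker] [FiniteDimensional ℂ (q * B).ker]
    (hr : (q * B).range = q.range) :
    B.IsFredholm ∧
      fredholmIndex B = Module.finrank ℂ (q * B).ker - Module.finrank ℂ q.ker := by
  have hker : B.ker ≤ (q * B).ker := by
    intro x hx
    have : B x = 0 := hx
    change q (B x) = 0
    rw [this, map_zero]
  have hfk : FiniteDimensional ℂ B.ker := Submodule.finiteDimensional_of_le hker
  let f : q.ker →ₗ[ℂ] E ⧸ B.range := B.range.mkQ ∘ₗ q.ker.subtype
  have hf : Function.Surjective f := by
    intro z
    obtain ⟨y, rfl⟩ := B.range.mkQ_surjective z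
    obtain ⟨x, hx⟩ : q y ∈ (q * B).range := by rw [hr]; exact ⟨y, rfl⟩
    have hx : q (B x) = q y := hx
    refine ⟨⟨y - B x, ?_⟩, ?_⟩
    · change q (y - B x) = 0
      rw [map_sub, hx, sub_self]
    · change B.range.mkQ (y - B x) = B.range.mkQ y
      have : B.range.mkQ (B x) = 0 := by
        rw [Submodule.mkQ_apply, Submodule.Quotient.mk_eq_zero]
        exact ⟨x, rfl⟩
      rw [map_sub, this, sub_zero]
  have hfc : FiniteDimensional ℂ (E ⧸ B.range) := Module.Finite.of_surjective f hf
  refine ⟨(isFredholm_iff B).2 ⟨hfk, hfc⟩, ?_⟩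
  let g : (q * B).ker →ₗ[ℂ] q.ker := (B : E →ₗ[ℂ] E).restrict fun x hx => hx
  have e1 : g.ker ≃ₗ[ℂ] B.ker :=
    LinearEquiv.ofBijective
      ((((q * B).ker.subtype ∘ₗ g.ker.subtype).codRestrict B.ker)
        fun x => congrArg Subtype.val x.2)
      ⟨fun x y h => by
          have h' := congrArg Subtype.val h
          exact Subtype.ext (Subtype.ext h'),
        fun x => ⟨⟨⟨x, hker x.2⟩, Subtype.ext x.2⟩, rfl⟩⟩
  have e2 : g.range = f.ker := by
    ext y
    have : y ∈ f.ker ↔ (y : E) ∈ B.range := Submodule.Quotient.mk_eq_zero _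
    rw [this]
    constructor
    · rintro ⟨x, rfl⟩
      exact ⟨x, rfl⟩
    · rintro ⟨x, hx⟩
      exact ⟨⟨x, (congrArg q hx).trans y.2⟩, Subtype.ext hx⟩
  have r1 := g.finrank_range_add_finrank_ker
  have r2 := f.finrank_range_add_finrank_ker
  rw [e1.finrank_eq, e2] at r1
  rw [LinearMap.range_eq_top.2 hf, finrank_top] at r2
  unfold fredholmIndex
  omega

theorem exists_mul_mul_eq_of_isFredholm {A : E →L[ℂ] E} (hA : A.IsFredholm) :
    ∃ R : E →L[ℂ] E, A * R * A = A := by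
  obtain ⟨pkg⟩ := hA.nonempty_fredholmPackage
  refine ⟨pkg.quasiInverse, ?_⟩
  have h := pkg.eq_equiv
  have hR : pkg.quasiInverse =
    pkg.decDom.X₁.subtypeL ∘L pkg.equiv.symm ∘L pkg.decCodom.proj := rfl
  generalize pkg.quasiInverse = R at hR
  subst hR
  ext x
  have hx := DFunLike.congr_fun h x
  change A x = (pkg.equiv (pkg.decDom.proj x) : E) at hx
  change A (pkg.equiv.symm (pkg.decCodom.proj (A x)) : E) = A x
  have hproj : ∀ y : pkg.decCodom.X₁, pkg.decCodom.proj (y : E) = y := fun y =>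
    Submodule.projectionOnto_apply_left _ y
  have hproj' : ∀ y : pkg.decDom.X₁, pkg.decDom.proj (y : E) = y := fun y =>
    Submodule.projectionOnto_apply_left _ y
  have hy := DFunLike.congr_fun h (pkg.equiv.symm (pkg.decCodom.proj (A x)) : E)
  change A _ = (pkg.equiv (pkg.decDom.proj _) : E) at hy
  rw [hy, hproj', ContinuousLinearEquiv.apply_symm_apply, hx, hproj]

/-- The Fredholm operators form an open set, on which the index is locally constant. -/
theorem eventually_fredholmIndex_eq [CompleteSpace E] {A : E →L[ℂ] E} (hA : A.IsFredholm) :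
    ∀ᶠ B in 𝓝 A, B.IsFredholm ∧ fredholmIndex B = fredholmIndex A := by
  obtain ⟨R, hR⟩ := exists_mul_mul_eq_of_isFredholm hA
  obtain ⟨hk, hc⟩ := (isFredholm_iff A).1 hA
  have hq : IsIdempotentElem (A * R) := by
    change A * R * (A * R) = A * R
    rw [← mul_assoc, hR]
  have hrange : (A * R).range = A.range := by
    apply le_antisymm
    · rintro _ ⟨x, rfl⟩
      exact ⟨R x, rfl⟩
    · rintro _ ⟨x, rfl⟩
      exact ⟨A x, DFunLike.congr_fun hR x⟩
  have hcompl : IsCompl (A * R).range (A * R).ker :=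
    LinearMap.IsIdempotentElem.isCompl (f := (A * R).toLinearMap)
      (congrArg ContinuousLinearMap.toLinearMap hq)
  let e : (E ⧸ A.range) ≃ₗ[ℂ] (A * R).ker :=
    (Submodule.quotEquivOfEq _ _ hrange.symm).trans
      (Submodule.quotientEquivOfIsCompl _ _ hcompl)
  have hkq : FiniteDimensional ℂ (A * R).ker := e.finiteDimensional
  have hunit : ∀ᶠ B in 𝓝 A, IsUnit (1 + R * (B - A)) := by
    have hcont : ContinuousAt (fun B : E →L[ℂ] E => 1 + R * (B - A)) A := by fun_prop
    refine hcont.eventually ?_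
    beta_reduce
    rw [sub_self, mul_zero, add_zero]
    exact (Units.isOpen (R := E →L[ℂ] E)).mem_nhds isUnit_one
  filter_upwards [hunit] with B hB
  obtain ⟨u, hu⟩ := hB
  have hqB : A * R * B = A * u := by
    rw [hu, mul_add, mul_one, ← mul_assoc, mul_sub, hR]
    abel
  have hinv : ∀ x, (↑u⁻¹ : E →L[ℂ] E) ((u : E →L[ℂ] E) x) = x := fun x =>
    DFunLike.congr_fun (Units.inv_mul u) x
  have hinv' : ∀ x, (u : E →L[ℂ] E) ((↑u⁻¹ : E →L[ℂ] E) x) = x := fun x =>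
    DFunLike.congr_fun (Units.mul_inv u) x
  let eu : E ≃ₗ[ℂ] E :=
    { (u : E →L[ℂ] E).toLinearMap with
      invFun := (↑u⁻¹ : E →L[ℂ] E)
      left_inv := hinv
      right_inv := hinv' }
  have hr : (A * R * B).range = (A * R).range := by
    rw [hqB, hrange]
    apply le_antisymm
    · rintro _ ⟨x, rfl⟩
      exact ⟨(u : E →L[ℂ] E) x, rfl⟩
    · rintro _ ⟨x, rfl⟩
      exact ⟨(↑u⁻¹ : E →L[ℂ] E) x, congrArg A (hinv' x)⟩
  have hcomap : (A * R * B).ker = A.ker.comap (eu : E →ₗ[ℂ] E) := by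
    rw [hqB]; rfl
  let ek : A.ker ≃ₗ[ℂ] (A * R * B).ker :=
    (eu.ofSubmodule' A.ker).symm.trans (LinearEquiv.ofEq _ _ hcomap.symm)
  have hkB : FiniteDimensional ℂ (A * R * B).ker := ek.finiteDimensional
  obtain ⟨h1, h2⟩ := fredholmIndex_of_range_comp_eq hr
  refine ⟨h1, ?_⟩
  rw [h2, ← ek.finrank_eq, ← e.finrank_eq]
  rfl

end Fredholm

section SeqSpace

variable {X : Type*} [NormedAddCommGroup X] [NormedSpace ℂ X] {p : ℝ≥0∞} [Fact (1 ≤ p)]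

local notation "L(E)" => SeqSpace X p →L[ℂ] SeqSpace X p

theorem shift_apply (k : ℤ) (x : SeqSpace X p) (n : ℤ) : shift X p k x n = x (n - k) := rfl

open Classical in
theorem coordProj_apply (S : Set ℤ) (x : SeqSpace X p) (n : ℤ) :
    coordProj X p S x n = if n ∈ S then x n else 0 := rfl

theorem shift_mul_shift (j k : ℤ) : shift X p j * shift X p k = shift X p (j + k) := by
  ext x n
  change x (n - j - k) = x (n - (j + k))
  rw [sub_sub]

theorem shift_zero : shift X p 0 = 1 := by
  ext x n
  change x (n - 0) = x n
  rw [sub_zero]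

theorem shift_neg_mul_shift (k : ℤ) : shift X p (-k) * shift X p k = 1 := by
  rw [shift_mul_shift, neg_add_cancel, shift_zero]

theorem shift_mul_shift_neg (k : ℤ) : shift X p k * shift X p (-k) = 1 := by
  rw [shift_mul_shift, add_neg_cancel, shift_zero]

theorem norm_shift_apply_le (k : ℤ) (x : SeqSpace X p) : ‖shift X p k x‖ ≤ ‖x‖ :=
  norm_shift_le x k

theorem norm_shift_le_one (k : ℤ) : ‖shift X p k‖ ≤ 1 :=
  ContinuousLinearMap.opNorm_le_bound _ zero_le_one fun x => by
    simpa using norm_shift_apply_le k x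

theorem norm_shift_apply (k : ℤ) (x : SeqSpace X p) : ‖shift X p k x‖ = ‖x‖ := by
  refine le_antisymm (norm_shift_apply_le k x) ?_
  have h : shift X p (-k) (shift X p k x) = x := DFunLike.congr_fun (shift_neg_mul_shift k) x
  calc ‖x‖ = ‖shift X p (-k) (shift X p k x)‖ := by rw [h]
    _ ≤ _ := norm_shift_apply_le _ _

theorem norm_coordProj_apply_le (S : Set ℤ) (x : SeqSpace X p) : ‖coordProj X p S x‖ ≤ ‖x‖ := by
  classical
  refine lp.norm_mono (zero_lt_one.trans_le (Fact.out : 1 ≤ p)).ne' fun n => ?_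
  rw [coordProj_apply]
  split_ifs <;> simp

theorem norm_coordProj_le_one (S : Set ℤ) : ‖coordProj X p S‖ ≤ 1 :=
  ContinuousLinearMap.opNorm_le_bound _ zero_le_one fun x => by
    simpa using norm_coordProj_apply_le S x

theorem coordProj_mul_coordProj (S T : Set ℤ) :
    coordProj X p S * coordProj X p T = coordProj X p (S ∩ T) := by
  classical
  ext x n
  change coordProj X p S (coordProj X p T x) n = _
  simp only [coordProj_apply, Set.mem_inter_iff]
  split_ifs <;> simp_all

theorem one_sub_coordProj (S : Set ℤ) : 1 - coordProj X p S = coordProj X p Sᶜ := by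
  classical
  ext x n
  change x n - coordProj X p S x n = _
  simp only [coordProj_apply, Set.mem_compl_iff]
  split_ifs <;> simp_all

theorem minusProj_eq : minusProj X p = coordProj X p {k : ℤ | 0 ≤ k}ᶜ := one_sub_coordProj _

theorem norm_coordProj_mul_le (S : Set ℤ) (A : L(E)) : ‖coordProj X p S * A‖ ≤ ‖A‖ :=
  (norm_mul_le _ _).trans (mul_le_of_le_one_left (norm_nonneg _) (norm_coordProj_le_one S))

theorem norm_mul_coordProj_le (S : Set ℤ) (A : L(E)) : ‖A * coordProj X p S‖ ≤ ‖A‖ :=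
  (norm_mul_le _ _).trans (mul_le_of_le_one_right (norm_nonneg _) (norm_coordProj_le_one S))

theorem norm_shift_conj_le (A : L(E)) (k : ℤ) : ‖shift X p (-k) * A * shift X p k‖ ≤ ‖A‖ :=
  calc ‖shift X p (-k) * A * shift X p k‖
      ≤ ‖shift X p (-k) * A‖ * ‖shift X p k‖ := norm_mul_le _ _
    _ ≤ ‖shift X p (-k) * A‖ := mul_le_of_le_one_right (norm_nonneg _) (norm_shift_le_one _)
    _ ≤ ‖shift X p (-k)‖ * ‖A‖ := norm_mul_le _ _
    _ ≤ ‖A‖ := mul_le_of_le_one_left (norm_nonneg _) (norm_shift_le_one _)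

theorem finProj_eq_sum (k : ℕ) :
    finProj X p k = ∑ i ∈ Finset.Icc (-(k : ℤ)) k,
      (lp.singleContinuousLinearMap ℂ (fun _ : ℤ => X) p i).comp
        (lp.evalCLM ℂ (fun _ : ℤ => X) p i) := by
  classical
  ext x n
  rw [sum_apply, lp.coeFn_sum, Finset.sum_apply]
  have : ∀ i, (((lp.singleContinuousLinearMap ℂ (fun _ : ℤ => X) p i).comp
      (lp.evalCLM ℂ (fun _ : ℤ => X) p i)) x : ℤ → X) n = if n = i then x i else 0 := by
    intro i
    change (lp.single p i (x i) : ℤ → X) n = _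
    rw [lp.single_apply]
    by_cases h : n = i
    · subst h; simp
    · rw [if_neg h, Pi.single_eq_of_ne h]
  simp only [this, Finset.sum_ite_eq, finProj, coordProj_apply, Finset.mem_Icc,
    Set.mem_ofPred_eq, abs_le]

theorem tendsto_finProj (hp : p ≠ ∞) (x : SeqSpace X p) :
    Tendsto (fun k => finProj X p k x) atTop (𝓝 x) := by
  have hmono : Tendsto (fun k : ℕ => Finset.Icc (-(k : ℤ)) k) atTop atTop := by
    refine tendsto_atTop_finset_of_monotone ?_ ?_
    · intro a b hab
      exact Finset.Icc_subset_Icc (by simpa using hab) (by simpa using hab)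
    · intro n
      refine ⟨n.natAbs, ?_⟩
      rw [Finset.mem_Icc]
      omega
  refine ((lp.hasSum_single hp x).comp hmono).congr fun k => ?_
  rw [finProj_eq_sum, sum_apply]
  rfl

omit [NormedSpace ℂ X] in
theorem norm_add_rpow_of_disjoint (hp : p ≠ ∞) {x y : SeqSpace X p}
    (h : ∀ n, x n = 0 ∨ y n = 0) :
    ‖x + y‖ ^ p.toReal = ‖x‖ ^ p.toReal + ‖y‖ ^ p.toReal := by
  have hp0 : 0 < p.toReal := ENNReal.toReal_pos (zero_lt_one.trans_le (Fact.out : 1 ≤ p)).ne' hp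
  have hx := lp.hasSum_norm hp0 x
  have hy := lp.hasSum_norm hp0 y
  refine (lp.hasSum_norm hp0 (x + y)).unique ((hx.add hy).congr_fun ?_)
  intro n
  rw [lp.coeFn_add, Pi.add_apply]
  rcases h n with h | h <;> simp [h, Real.zero_rpow hp0.ne']

/-- A sequence of vectors *escapes to infinity* if it is bounded and its entries over every
bounded set of indices tend to zero. For `1 < p < ∞` such sequences tend weakly to zero. -/
def EscapesToInfinity (z : ℕ → SeqSpace X p) : Prop :=
  (∃ C, ∀ n, ‖z n‖ ≤ C) ∧ ∀ k, Tendsto (fun n => finProj X p k (z n)) atTop (𝓝 0)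

theorem escapesToInfinity_shift (hp : p ≠ ∞) {h : ℕ → ℤ}
    (hh : Tendsto (fun n => |h n|) atTop atTop) (x : SeqSpace X p) :
    EscapesToInfinity fun n => shift X p (h n) x := by
  refine ⟨⟨‖x‖, fun n => norm_shift_apply_le _ _⟩, fun k => ?_⟩
  rw [Metric.tendsto_nhds]
  intro ε hε
  obtain ⟨m, hm⟩ := ((Metric.tendsto_nhds.1 (tendsto_finProj hp x)) ε hε).exists
  filter_upwards [hh.eventually_gt_atTop ((k : ℤ) + m)] with n hn
  rw [dist_zero_right]
  have hzero : finProj X p k (shift X p (h n) (finProj X p m x)) = 0 := by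
    classical
    ext j
    rw [finProj, finProj, coordProj_apply, shift_apply, coordProj_apply]
    split_ifs with h1 h2
    · exfalso
      rw [Set.mem_ofPred_eq] at h1 h2
      have : |h n| ≤ |j| + |j - h n| := by
        calc |h n| = |j - (j - h n)| := by ring_nf
          _ ≤ _ := abs_sub _ _
      omega
    · rfl
    · rfl
  calc ‖finProj X p k (shift X p (h n) x)‖
      = ‖finProj X p k (shift X p (h n) (x - finProj X p m x))‖ := by
        rw [map_sub, map_sub, hzero, sub_zero]
    _ ≤ ‖shift X p (h n) (x - finProj X p m x)‖ := norm_coordProj_apply_le _ _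
    _ ≤ ‖x - finProj X p m x‖ := norm_shift_apply_le _ _
    _ < ε := by rwa [← dist_eq_norm, dist_comm]

theorem one_sub_finProj_mul {k m : ℕ} (h : k ≤ m) :
    (1 - finProj X p k) * (1 - finProj X p m) = 1 - finProj X p m := by
  rw [finProj, finProj, one_sub_coordProj, one_sub_coordProj, coordProj_mul_coordProj]
  congr 1
  ext j
  simp only [Set.mem_inter_iff, Set.mem_compl_iff, Set.mem_ofPred_eq]
  omega

theorem one_sub_finProj_mul_finProj_mul (k m : ℕ) :
    (1 - finProj X p k) * (finProj X p m * (1 - finProj X p k)) =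
      finProj X p m * (1 - finProj X p k) := by
  rw [finProj, finProj, one_sub_coordProj, coordProj_mul_coordProj, coordProj_mul_coordProj]
  congr 1
  ext j
  simp only [Set.mem_inter_iff, Set.mem_compl_iff, Set.mem_ofPred_eq]
  tauto

theorem norm_one_sub_finProj_apply_le (k : ℕ) (x : SeqSpace X p) :
    ‖(1 - finProj X p k) x‖ ≤ ‖x‖ := by
  rw [finProj, one_sub_coordProj]
  exact norm_coordProj_apply_le _ x

theorem tendsto_norm_comp_one_sub_finProj (hp1 : 1 < p) (hp : p ≠ ∞)
    (f : StrongDual ℂ (SeqSpace X p)) :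
    Tendsto (fun k => ‖f.comp (1 - finProj X p k)‖) atTop (𝓝 0) := by
  set a : ℕ → ℝ := fun k => ‖f.comp (1 - finProj X p k)‖ with ha
  have hp1' : 1 < p.toReal := by
    have := (ENNReal.toReal_lt_toReal ENNReal.one_ne_top hp).2 hp1
    simpa using this
  have hp0 : 0 < p.toReal := by linarith
  have hle : ∀ k z, (1 - finProj X p k) z = z → ‖f z‖ ≤ a k * ‖z‖ := by
    intro k z hz
    have := (f.comp (1 - finProj X p k)).le_opNorm z
    rwa [ContinuousLinearMap.comp_apply, hz] at this
  have hanti : Antitone a := by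
    intro k m hkm
    refine ContinuousLinearMap.opNorm_le_bound _ (norm_nonneg _) fun x => ?_
    refine (hle k _ (DFunLike.congr_fun (one_sub_finProj_mul hkm) x)).trans ?_
    exact mul_le_mul_of_nonneg_left (norm_one_sub_finProj_apply_le m x) (norm_nonneg _)
  have hbdd : BddBelow (Set.range a) := ⟨0, by rintro _ ⟨k, rfl⟩; exact norm_nonneg _⟩
  set c := ⨅ k, a k with hc
  have hlim : Tendsto a atTop (𝓝 c) := tendsto_atTop_ciInf hanti hbdd
  have hca : ∀ k, c ≤ a k := fun k => ciInf_le hbdd k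
  have hc0 : 0 ≤ c := le_ciInf fun k => norm_nonneg _
  set s : ℝ := 2 ^ (1 / p.toReal) with hs
  have hs0 : 0 < s := Real.rpow_pos_of_pos two_pos _
  have hs2 : s < 2 := by
    have : s < 2 ^ (1 : ℝ) :=
      Real.rpow_lt_rpow_of_exponent_lt one_lt_two ((div_lt_one hp0).2 hp1')
    rwa [Real.rpow_one] at this
  have key : ∀ d e, d < c → c < e → d ≤ s / 2 * e := by
    intro d e hd he
    obtain ⟨k, hk⟩ := (hlim.eventually_lt_const he).exists
    obtain ⟨x, hx1, hx⟩ := (f.comp (1 - finProj X p k)).exists_lt_apply_of_lt_opNorm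
      (hd.trans_le (hca k))
    rw [ContinuousLinearMap.comp_apply] at hx
    have hev : ∀ᶠ m in atTop, d < ‖f (finProj X p m ((1 - finProj X p k) x))‖ :=
      (((f.continuous.tendsto _).comp (tendsto_finProj hp _)).norm).eventually_const_lt hx
    obtain ⟨m, hm, hkm⟩ := (hev.and (eventually_ge_atTop k)).exists
    obtain ⟨y, hy1, hy⟩ := (f.comp (1 - finProj X p m)).exists_lt_apply_of_lt_opNorm
      (hd.trans_le (hca m))
    rw [ContinuousLinearMap.comp_apply] at hy
    set u := finProj X p m ((1 - finProj X p k) x) with hu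
    set v := (1 - finProj X p m) y with hv
    have hu1 : ‖u‖ ≤ 1 :=
      ((norm_coordProj_apply_le _ _).trans (norm_one_sub_finProj_apply_le _ _)).trans hx1.le
    have hv1 : ‖v‖ ≤ 1 := (norm_one_sub_finProj_apply_le _ _).trans hy1.le
    obtain ⟨α, hα, hfu⟩ := Complex.exists_norm_eq_mul_self (f u)
    obtain ⟨β, hβ, hfv⟩ := Complex.exists_norm_eq_mul_self (f v)
    have hdisj : ∀ n, (α • u) n = 0 ∨ (β • v) n = 0 := by
      classical
      intro n
      rw [lp.coeFn_smul, lp.coeFn_smul, Pi.smul_apply, Pi.smul_apply, hu, hv, finProj,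
        one_sub_coordProj, coordProj_apply, coordProj_apply]
      by_cases hn : n ∈ {k : ℤ | |k| ≤ (m : ℤ)}
      · right; rw [if_neg (by simpa using hn), smul_zero]
      · left; rw [if_neg hn, smul_zero]
    have hz : ‖α • u + β • v‖ ≤ s := by
      have h1 := norm_add_rpow_of_disjoint hp hdisj
      rw [norm_smul, norm_smul, hα, hβ, one_mul, one_mul] at h1
      have h2 : ‖α • u + β • v‖ ^ p.toReal ≤ 2 := by
        rw [h1]
        have := Real.rpow_le_one (norm_nonneg u) hu1 hp0.le
        have := Real.rpow_le_one (norm_nonneg v) hv1 hp0.le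
        linarith
      rw [hs, one_div]
      exact (Real.le_rpow_inv_iff_of_pos (norm_nonneg _) zero_le_two hp0).2 h2
    have hfix : (1 - finProj X p k) (α • u + β • v) = α • u + β • v := by
      have e1 : (1 - finProj X p k) u = u :=
        DFunLike.congr_fun (one_sub_finProj_mul_finProj_mul k m) x
      have e2 : (1 - finProj X p k) v = v := DFunLike.congr_fun (one_sub_finProj_mul hkm) y
      rw [map_add, map_smul, map_smul, e1, e2]
    have hfz : ‖f (α • u + β • v)‖ = ‖f u‖ + ‖f v‖ := by
      rw [map_add, map_smul, map_smul, smul_eq_mul, smul_eq_mul, ← hfu, ← hfv,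
        ← Complex.ofReal_add, Complex.norm_real, Real.norm_of_nonneg (by positivity)]
    have h3 := hle k _ hfix
    have h4 : a k * ‖α • u + β • v‖ ≤ e * s :=
      mul_le_mul hk.le hz (norm_nonneg _) (hc0.trans he.le)
    linarith
  have h1 : ∀ e, c < e → c ≤ s / 2 * e := fun e he =>
    le_of_forall_lt_imp_le_of_dense fun d hd => key d e hd he
  have h2 : c / (s / 2) ≤ c := le_of_forall_gt_imp_ge_of_dense fun e he => by
    rw [div_le_iff₀ (by positivity), mul_comm]
    exact h1 e he
  rw [div_le_iff₀ (by positivity)] at h2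
  have : c = 0 := by nlinarith
  rwa [this] at hlim

theorem EscapesToInfinity.tendsto_dual (hp1 : 1 < p) (hp : p ≠ ∞) {z : ℕ → SeqSpace X p}
    (hz : EscapesToInfinity z) (f : StrongDual ℂ (SeqSpace X p)) :
    Tendsto (fun n => f (z n)) atTop (𝓝 0) := by
  obtain ⟨⟨C, hC⟩, hz⟩ := hz
  have hC0 : 0 ≤ C := (norm_nonneg _).trans (hC 0)
  rw [Metric.tendsto_nhds]
  intro ε hε
  have h1 := (tendsto_norm_comp_one_sub_finProj hp1 hp f).mul_const C
  rw [zero_mul] at h1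
  obtain ⟨k, hk⟩ := (h1.eventually_lt_const (half_pos hε)).exists
  have h2 : Tendsto (fun n => ‖f (finProj X p k (z n))‖) atTop (𝓝 0) := by
    have := ((f.continuous.tendsto _).comp (hz k)).norm
    simpa using this
  filter_upwards [h2.eventually_lt_const (half_pos hε)] with n hn
  rw [dist_zero_right]
  have h3 : f (z n) = f (finProj X p k (z n)) + f.comp (1 - finProj X p k) (z n) := by
    change _ = _ + f (z n - finProj X p k (z n))
    rw [map_sub, add_sub_cancel]
  have h4 : ‖f.comp (1 - finProj X p k) (z n)‖ ≤ ‖f.comp (1 - finProj X p k)‖ * C :=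
    ((f.comp (1 - finProj X p k)).le_opNorm _).trans
      (mul_le_mul_of_nonneg_left (hC n) (norm_nonneg _))
  have h5 := norm_add_le (f (finProj X p k (z n))) (f.comp (1 - finProj X p k) (z n))
  rw [h3]
  linarith

theorem EscapesToInfinity.tendsto_of_hasFiniteRange (hp1 : 1 < p) (hp : p ≠ ∞)
    {z : ℕ → SeqSpace X p} (hz : EscapesToInfinity z) {T : L(E)}
    (hT : T.toLinearMap.HasFiniteRange) : Tendsto (fun n => T (z n)) atTop (𝓝 0) := by
  have hfin : FiniteDimensional ℂ T.range := Module.Finite.of_fg hT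
  let e : T.range ≃L[ℂ] (Fin (Module.finrank ℂ T.range) → ℂ) :=
    (Module.finBasis ℂ T.range).equivFunL
  let T' : SeqSpace X p →L[ℂ] T.range := T.codRestrict T.range fun x => ⟨x, rfl⟩
  have h1 : Tendsto (fun n => e (T' (z n))) atTop (𝓝 0) := by
    rw [tendsto_pi_nhds]
    intro i
    exact hz.tendsto_dual hp1 hp
      ((ContinuousLinearMap.proj (R := ℂ) (φ := fun _ : Fin _ => ℂ) i).comp
        ((e : T.range →L[ℂ] (Fin (Module.finrank ℂ T.range) → ℂ)).comp T'))
  have h2 := (T.range.subtypeL.continuous.tendsto _).comp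
    ((e.symm.continuous.tendsto _).comp h1)
  rw [map_zero, map_zero] at h2
  refine h2.congr fun n => ?_
  change ((e.symm (e (T' (z n))) : T.range) : SeqSpace X p) = T (z n)
  rw [e.symm_apply_apply]
  rfl

end SeqSpace

section LimitOperators

variable {X : Type*} [NormedAddCommGroup X] [NormedSpace ℂ X] {p : ℝ≥0∞} [Fact (1 ≤ p)]

local notation "L(E)" => SeqSpace X p →L[ℂ] SeqSpace X p

theorem norm_le_of_tendsto_apply {T : ℕ → L(E)} {B : L(E)} {c : ℝ} (hc : 0 ≤ c)
    (hT : ∀ x, Tendsto (fun n => T n x) atTop (𝓝 (B x))) (hb : ∀ n, ‖T n‖ ≤ c) : ‖B‖ ≤ c :=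
  ContinuousLinearMap.opNorm_le_bound _ hc fun x =>
    le_of_tendsto (hT x).norm <| Eventually.of_forall fun n =>
      ((T n).le_opNorm x).trans (mul_le_mul_of_nonneg_right (hb n) (norm_nonneg _))

theorem IsLimitOperator.comp_strictMono {A B : L(E)} {h : ℕ → ℤ} (hB : IsLimitOperator A h B)
    {φ : ℕ → ℕ} (hφ : StrictMono φ) : IsLimitOperator A (h ∘ φ) B := fun k =>
  ⟨(hB k).1.comp hφ.tendsto_atTop, (hB k).2.comp hφ.tendsto_atTop⟩

theorem IsLimitOperator.sub {A A' B B' : L(E)} {h : ℕ → ℤ} (hB : IsLimitOperator A h B)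
    (hB' : IsLimitOperator A' h B') : IsLimitOperator (A - A') h (B - B') := by
  intro k
  have e : ∀ n, shift X p (-h n) * (A - A') * shift X p (h n) - (B - B') =
      (shift X p (-h n) * A * shift X p (h n) - B) -
        (shift X p (-h n) * A' * shift X p (h n) - B') := by
    intro n
    rw [mul_sub, sub_mul]
    abel
  constructor
  · have := (hB k).1.add (hB' k).1
    rw [add_zero] at this
    refine squeeze_zero (fun n => norm_nonneg _) (fun n => ?_) this
    rw [e, mul_sub]
    exact norm_sub_le _ _
  · have := (hB k).2.add (hB' k).2
    rw [add_zero] at this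
    refine squeeze_zero (fun n => norm_nonneg _) (fun n => ?_) this
    rw [e, sub_mul]
    exact norm_sub_le _ _

theorem isLimitOperator_one (h : ℕ → ℤ) : IsLimitOperator (1 : L(E)) h 1 := by
  intro k
  have e : ∀ n, shift X p (-h n) * 1 * shift X p (h n) - 1 = 0 := by
    intro n
    rw [mul_one, shift_neg_mul_shift, sub_self]
  simp only [e, mul_zero, zero_mul, norm_zero]
  exact ⟨tendsto_const_nhds, tendsto_const_nhds⟩

theorem IsLimitOperator.tendsto_apply (hp : p ≠ ∞) {A B : L(E)} {h : ℕ → ℤ}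
    (hB : IsLimitOperator A h B) (x : SeqSpace X p) :
    Tendsto (fun n => (shift X p (-h n) * A * shift X p (h n)) x) atTop (𝓝 (B x)) := by
  set T : ℕ → L(E) := fun n => shift X p (-h n) * A * shift X p (h n) - B with hT
  suffices hs : Tendsto (fun n => T n x) atTop (𝓝 0) by
    have := hs.add_const (B x)
    rw [zero_add] at this
    refine this.congr fun n => ?_
    change (shift X p (-h n) * A * shift X p (h n)) x - B x + B x = _
    rw [sub_add_cancel]
  have hbd : ∀ n, ‖T n‖ ≤ ‖A‖ + ‖B‖ := fun n =>
    (norm_sub_le _ _).trans (add_le_add_left (norm_shift_conj_le A (h n)) _)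
  rw [Metric.tendsto_nhds]
  intro ε hε
  have h1 : Tendsto (fun k => (‖A‖ + ‖B‖) * ‖x - finProj X p k x‖) atTop (𝓝 0) := by
    have := ((tendsto_const_nhds (x := x)).sub (tendsto_finProj hp x)).norm.const_mul (‖A‖ + ‖B‖)
    simpa using this
  obtain ⟨k, hk⟩ := (h1.eventually_lt_const (half_pos hε)).exists
  have h2 := ((hB k).2.mul_const ‖x‖)
  rw [zero_mul] at h2
  filter_upwards [h2.eventually_lt_const (half_pos hε)] with n hn
  rw [dist_zero_right]
  have h3 : T n x = T n (x - finProj X p k x) + (T n * finProj X p k) x := by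
    change _ = _ + T n (finProj X p k x)
    rw [map_sub, sub_add_cancel]
  have h4 : ‖T n (x - finProj X p k x)‖ ≤ (‖A‖ + ‖B‖) * ‖x - finProj X p k x‖ :=
    ((T n).le_opNorm _).trans (mul_le_mul_of_nonneg_right (hbd n) (norm_nonneg _))
  have h5 : ‖(T n * finProj X p k) x‖ ≤ ‖T n * finProj X p k‖ * ‖x‖ :=
    (T n * finProj X p k).le_opNorm x
  rw [h3]
  have := norm_add_le (T n (x - finProj X p k x)) ((T n * finProj X p k) x)
  linarith

theorem IsLimitOperator.norm_le (hp : p ≠ ∞) {A B : L(E)} {h : ℕ → ℤ}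
    (hB : IsLimitOperator A h B) : ‖B‖ ≤ ‖A‖ :=
  norm_le_of_tendsto_apply (norm_nonneg _) (fun x => hB.tendsto_apply hp x)
    fun n => norm_shift_conj_le A (h n)

theorem IsLimitOperator.norm_le_mul_norm (hp1 : 1 < p) (hp : p ≠ ∞) {A B R : L(E)} {h : ℕ → ℤ}
    (hh : Tendsto (fun n => |h n|) atTop atTop) (hB : IsLimitOperator A h B)
    (hR : (R * A - 1 : L(E)).toLinearMap.HasFiniteRange) (x : SeqSpace X p) :
    ‖x‖ ≤ ‖R‖ * ‖B x‖ := by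
  have h1 := ((escapesToInfinity_shift hp hh x).tendsto_of_hasFiniteRange hp1 hp hR).norm
  have h2 := ((hB.tendsto_apply hp x).norm.const_mul ‖R‖).add h1
  rw [norm_zero, add_zero] at h2
  refine ge_of_tendsto h2 (Eventually.of_forall fun n => ?_)
  have e : shift X p (h n) x = R (A (shift X p (h n) x)) - (R * A - 1) (shift X p (h n) x) := by
    change _ = _ - (R (A (shift X p (h n) x)) - shift X p (h n) x)
    rw [sub_sub_cancel]
  have e' : ‖(shift X p (-h n) * A * shift X p (h n)) x‖ = ‖A (shift X p (h n) x)‖ :=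
    norm_shift_apply _ _
  calc ‖x‖ = ‖shift X p (h n) x‖ := (norm_shift_apply _ _).symm
    _ = ‖R (A (shift X p (h n) x)) - (R * A - 1) (shift X p (h n) x)‖ := by rw [← e]
    _ ≤ ‖R (A (shift X p (h n) x))‖ + ‖(R * A - 1) (shift X p (h n) x)‖ := norm_sub_le _ _
    _ ≤ _ := by
      rw [e']
      exact add_le_add_left (R.le_opNorm _) _

theorem IsLimitOperator.dual_apply_eq_zero (hp1 : 1 < p) (hp : p ≠ ∞) {A B R : L(E)} {h : ℕ → ℤ}
    (hh : Tendsto (fun n => |h n|) atTop atTop) (hB : IsLimitOperator A h B)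
    (hR : (A * R - 1 : L(E)).toLinearMap.HasFiniteRange) {f : StrongDual ℂ (SeqSpace X p)}
    (hf : ∀ x, f (B x) = 0) (y : SeqSpace X p) : f y = 0 := by
  set z : ℕ → SeqSpace X p := fun n => (shift X p (-h n) * R * shift X p (h n)) y with hz
  have hzb : ∀ n, ‖z n‖ ≤ ‖R‖ * ‖y‖ := fun n =>
    (ContinuousLinearMap.le_opNorm _ _).trans
      (mul_le_mul_of_nonneg_right (norm_shift_conj_le R (h n)) (norm_nonneg _))
  have hAz : ∀ n, (shift X p (-h n) * A * shift X p (h n)) (z n) =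
      y + shift X p (-h n) ((A * R - 1) (shift X p (h n) y)) := by
    intro n
    have e1 : ∀ w, shift X p (h n) (shift X p (-h n) w) = w := fun w =>
      DFunLike.congr_fun (shift_mul_shift_neg (h n)) w
    have e2 : shift X p (-h n) (shift X p (h n) y) = y :=
      DFunLike.congr_fun (shift_neg_mul_shift (h n)) y
    change shift X p (-h n) (A (shift X p (h n) (shift X p (-h n) (R (shift X p (h n) y))))) =
      y + shift X p (-h n) (A (R (shift X p (h n) y)) - shift X p (h n) y)
    rw [e1, map_sub, e2, add_sub_cancel]
  have hesc : EscapesToInfinity fun n => y - B (z n) := by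
    refine ⟨⟨‖y‖ + ‖B‖ * (‖R‖ * ‖y‖), fun n => (norm_sub_le _ _).trans (add_le_add_right ?_ _)⟩,
      fun k => ?_⟩
    · exact (B.le_opNorm _).trans (mul_le_mul_of_nonneg_left (hzb n) (norm_nonneg _))
    · have h1 := ((escapesToInfinity_shift hp hh y).tendsto_of_hasFiniteRange hp1 hp hR).norm
      have h2 := ((hB k).1.mul_const (‖R‖ * ‖y‖)).add h1
      rw [norm_zero, zero_mul, add_zero] at h2
      refine squeeze_zero_norm (fun n => ?_) h2
      set D := shift X p (-h n) * A * shift X p (h n) - B with hD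
      have e : y - B (z n) = D (z n) - shift X p (-h n) ((A * R - 1) (shift X p (h n) y)) := by
        change _ = (shift X p (-h n) * A * shift X p (h n)) (z n) - B (z n) - _
        rw [hAz]
        abel
      beta_reduce
      rw [e, map_sub]
      refine (norm_sub_le _ _).trans (add_le_add ?_ ?_)
      · exact ((finProj X p k * D).le_opNorm (z n)).trans
          (mul_le_mul_of_nonneg_left (hzb n) (norm_nonneg _))
      · exact (norm_coordProj_apply_le _ _).trans (norm_shift_apply_le _ _)
  have h3 := hesc.tendsto_dual hp1 hp f
  have h4 : ∀ n, f (y - B (z n)) = f y := fun n => by rw [map_sub, hf, sub_zero]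
  simp only [h4] at h3
  exact tendsto_nhds_unique tendsto_const_nhds h3

/-- The limit operators of a Fredholm operator are invertible. -/
theorem IsLimitOperator.bijective_of_isFredholm [CompleteSpace X] (hp1 : 1 < p) (hp : p ≠ ∞)
    {A B : L(E)} {h : ℕ → ℤ} (hh : Tendsto (fun n => |h n|) atTop atTop)
    (hB : IsLimitOperator A h B) (hA : A.IsFredholm) : Function.Bijective B := by
  obtain ⟨R, hRA, hAR⟩ := isFredholm_iff_exists_quasiInverse.1 hA
  rw [ContinuousLinearMap.bijective_iff_dense_range_and_antilipschitz]
  refine ⟨?_, ‖R‖₊, ContinuousLinearMap.antilipschitz_of_bound B fun x => ?_⟩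
  · by_contra hne
    obtain ⟨y, hy⟩ : ∃ y, y ∉ B.range.topologicalClosure := by
      by_contra hall
      push Not at hall
      exact hne (eq_top_iff.2 fun y _ => hall y)
    set N := B.range.topologicalClosure with hN
    have hclosed : IsClosed (N : Set (SeqSpace X p)) := B.range.isClosed_topologicalClosure
    have hy0 : N.mkQL y ≠ 0 := fun h0 => hy ((Submodule.Quotient.mk_eq_zero N).1 h0)
    obtain ⟨g, hg⟩ := SeparatingDual.exists_ne_zero (R := ℂ) hy0
    refine hg (hB.dual_apply_eq_zero hp1 hp hh hAR (f := g.comp N.mkQL) (fun x => ?_) y)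
    have : N.mkQL (B x) = 0 :=
      (Submodule.Quotient.mk_eq_zero N).2 (B.range.le_topologicalClosure ⟨x, rfl⟩)
    rw [ContinuousLinearMap.comp_apply, this, map_zero]
  · exact hB.norm_le_mul_norm hp1 hp hh hRA x

end LimitOperators

section MatrixEntries

variable {X : Type*} [NormedAddCommGroup X] [NormedSpace ℂ X] {p : ℝ≥0∞} [Fact (1 ≤ p)]

local notation "L(E)" => SeqSpace X p →L[ℂ] SeqSpace X p

theorem entry_apply (A : L(E)) (i j : ℤ) (x : X) : entry A i j x = A (lp.single p j x) i := rfl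

theorem ext_entry (hp : p ≠ ∞) {A B : L(E)} (h : ∀ i j, entry A i j = entry B i j) : A = B := by
  refine ContinuousLinearMap.ext fun x => ?_
  have hx := lp.hasSum_single hp x
  refine (A.hasSum hx).unique ((B.hasSum hx).congr_fun fun j => ?_)
  ext i
  exact DFunLike.congr_fun (h i j) (x j)

theorem entry_sub (A B : L(E)) (i j : ℤ) : entry (A - B) i j = entry A i j - entry B i j := rfl

open Classical in
theorem entry_coordProj_mul_mul (S T : Set ℤ) (A : L(E)) (i j : ℤ) :
    entry (coordProj X p S * A * coordProj X p T) i j =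
      if i ∈ S ∧ j ∈ T then entry A i j else 0 := by
  ext x
  have h1 : coordProj X p T (lp.single p j x) = if j ∈ T then lp.single p j x else 0 := by
    ext n
    rw [coordProj_apply]
    by_cases hnj : n = j
    · subst hnj
      split_ifs <;> rfl
    · split_ifs <;> simp [hnj, lp.single_apply]
  change coordProj X p S (A (coordProj X p T (lp.single p j x))) i = _
  rw [coordProj_apply, h1]
  by_cases hi : i ∈ S <;> by_cases hj : j ∈ T <;> simp [hi, hj, entry_apply]

theorem entry_shift_conj (A : L(E)) (k i j : ℤ) :
    entry (shift X p (-k) * A * shift X p k) i j = entry A (i + k) (j + k) := by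
  ext x
  have h1 : shift X p k (lp.single p j x) = lp.single p (j + k) x := by
    ext n
    rw [shift_apply, lp.single_apply, lp.single_apply, Pi.single_apply, Pi.single_apply]
    simp only [sub_eq_iff_eq_add]
  change A (shift X p k (lp.single p j x)) (i - -k) = _
  rw [h1, sub_neg_eq_add]
  rfl

theorem norm_entry_le (A : L(E)) (i j : ℤ) : ‖entry A i j‖ ≤ ‖finProj X p i.natAbs * A‖ := by
  refine ContinuousLinearMap.opNorm_le_bound _ (norm_nonneg _) fun x => ?_
  have hp : 0 < p := zero_lt_one.trans_le Fact.out
  have h1 : entry A i j x = (finProj X p i.natAbs * A) (lp.single p j x) i := by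
    change A (lp.single p j x) i = finProj X p i.natAbs (A (lp.single p j x)) i
    rw [finProj, coordProj_apply, if_pos]
    rw [Set.mem_ofPred_eq, Int.natCast_natAbs]
  rw [h1]
  refine (lp.norm_apply_le_norm hp.ne' _ i).trans ?_
  refine (ContinuousLinearMap.le_opNorm _ _).trans_eq ?_
  rw [lp.norm_single hp]

theorem IsLimitOperator.tendsto_entry {A B : L(E)} {h : ℕ → ℤ} (hB : IsLimitOperator A h B)
    (i j : ℤ) : Tendsto (fun n => entry A (i + h n) (j + h n)) atTop (𝓝 (entry B i j)) := by
  rw [tendsto_iff_norm_sub_tendsto_zero]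
  refine squeeze_zero (fun n => norm_nonneg _) (fun n => ?_) (hB i.natAbs).1
  rw [← entry_shift_conj, ← entry_sub]
  exact norm_entry_le _ i j

theorem finProj_mul_mul_finProj_mem_approximable {A : L(E)}
    (hA : ∀ i j, entry A i j ∈ approximable X) (m : ℕ) :
    finProj X p m * A * finProj X p m ∈ approximable (SeqSpace X p) := by
  rw [finProj_eq_sum, Finset.sum_mul, Finset.sum_mul]
  refine approximable_sum _ fun i _ => ?_
  rw [Finset.mul_sum]
  refine approximable_sum _ fun j _ => ?_
  exact approximable_comp (hA i j) (lp.singleContinuousLinearMap ℂ (fun _ : ℤ => X) p i)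
    (lp.evalCLM ℂ (fun _ : ℤ => X) p j)

/-- In a space with the approximation property, compact operators are approximable. -/
theorem mem_approximable_of_isCompactOperator [CompleteSpace X] (hX : HasSAP X) {T : X →L[ℂ] X}
    (hT : IsCompactOperator T) : T ∈ approximable X := by
  obtain ⟨proj, -, hfin, hlim, -⟩ := hX
  obtain ⟨C, hC⟩ : ∃ C, ∀ N, ‖proj N‖ ≤ C := by
    refine banach_steinhaus fun x => ?_
    obtain ⟨C, hC⟩ := (hlim x).norm.bddAbove_range
    exact ⟨C, fun N => hC ⟨N, rfl⟩⟩
  have hC0 : 0 ≤ C := (norm_nonneg _).trans (hC 0)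
  rw [approximable, Metric.mem_closure_iff]
  intro ε hε
  obtain ⟨K, hK, hTK⟩ := hT.image_closedBall_subset_compact (f := T.toLinearMap) 1
  obtain ⟨t, -, htf, hKt⟩ := hK.finite_cover_balls (e := ε / (2 * (C + 2))) (by positivity)
  have hev : ∀ᶠ N in atTop, ∀ y ∈ t, ‖proj N y - y‖ < ε / (2 * (C + 2)) := by
    rw [Filter.eventually_all_finite htf]
    intro y _
    have := (tendsto_iff_norm_sub_tendsto_zero.1 (hlim y))
    exact this.eventually_lt_const (by positivity)
  obtain ⟨N, hN⟩ := hev.exists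
  refine ⟨proj N * T, ?_, ?_⟩
  · have := hfin N
    have h1 : (proj N).toLinearMap.HasFiniteRange :=
      LinearMap.hasFiniteRange_iff_range.2 (Submodule.fg_iff_finiteDimensional _ |>.2 this)
    exact h1.comp_right T.toLinearMap
  · rw [dist_comm, dist_eq_norm]
    refine lt_of_le_of_lt (b := ε / 2) ?_ (half_lt_self hε)
    refine ContinuousLinearMap.opNorm_le_of_unit_norm (half_pos hε).le fun x hx => ?_
    obtain ⟨y, hy, hxy⟩ : ∃ y ∈ t, T x ∈ Metric.ball y (ε / (2 * (C + 2))) := by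
      simpa using hKt (hTK ⟨x, by simp [hx], rfl⟩)
    rw [mem_ball_iff_norm] at hxy
    set δ := ε / (2 * (C + 2)) with hδ
    have e : (proj N * T - T) x = proj N (T x - y) + (proj N y - y) - (T x - y) := by
      change proj N (T x) - T x = _
      rw [map_sub]
      abel
    have h1 : ‖proj N (T x - y)‖ ≤ C * δ :=
      ((proj N).le_opNorm _).trans (mul_le_mul (hC N) hxy.le (norm_nonneg _) hC0)
    have h2 := hN y hy
    have h3 : (C + 2) * δ = ε / 2 := by
      rw [hδ]; field_simp
    rw [e]
    have h4 := norm_sub_le (proj N (T x - y) + (proj N y - y)) (T x - y)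
    have h5 := norm_add_le (proj N (T x - y)) (proj N y - y)
    linarith

end MatrixEntries

section Corners

variable {X : Type*} [NormedAddCommGroup X] [NormedSpace ℂ X] {p : ℝ≥0∞} [Fact (1 ≤ p)]

local notation "L(E)" => SeqSpace X p →L[ℂ] SeqSpace X p

/-- The part of a matrix with row indices in `S` and column indices outside `S`. -/
noncomputable def corner (S : Set ℤ) (A : L(E)) : L(E) := coordProj X p S * A * coordProj X p Sᶜ

/-- The difference between the corner of a matrix and its truncation to indices of modulus at
most `m`. -/
noncomputable def cornerTail (S : Set ℤ) (m : ℕ) (A : L(E)) : L(E) :=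
  corner S A - finProj X p m * corner S A * finProj X p m

theorem norm_corner_le (S : Set ℤ) (A : L(E)) : ‖corner S A‖ ≤ ‖A‖ :=
  (norm_mul_coordProj_le _ _).trans (norm_coordProj_mul_le _ _)

theorem norm_cornerTail_le (S : Set ℤ) (m : ℕ) (A : L(E)) : ‖cornerTail S m A‖ ≤ 2 * ‖A‖ := by
  have h1 := norm_corner_le S A
  have h2 : ‖finProj X p m * corner S A * finProj X p m‖ ≤ ‖corner S A‖ :=
    (norm_mul_coordProj_le _ _).trans (norm_coordProj_mul_le _ _)
  have h3 := norm_sub_le (corner S A) (finProj X p m * corner S A * finProj X p m)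
  unfold cornerTail
  linarith

theorem cornerTail_sub (S : Set ℤ) (m : ℕ) (A B : L(E)) :
    cornerTail S m (A - B) = cornerTail S m A - cornerTail S m B := by
  simp only [cornerTail, corner, mul_sub, sub_mul]
  abel

/-- The sets of indices of the two half-axes. -/
def IsHalfAxis (S : Set ℤ) : Prop := S = {k | 0 ≤ k} ∨ S = {k | 0 ≤ k}ᶜ

theorem IsHalfAxis.abs_le {S : Set ℤ} (hS : IsHalfAxis S) {i j : ℤ} (hi : i ∈ S) (hj : j ∉ S) :
    |i| ≤ |i - j| ∧ |j| ≤ |i - j| := by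
  have h : 0 ≤ i ∧ j < 0 ∨ i < 0 ∧ 0 ≤ j := by
    rcases hS with rfl | rfl
    · left; simpa using And.intro hi hj
    · right; simpa using And.intro hi hj
  rcases h with ⟨h1, h2⟩ | ⟨h1, h2⟩
  · rw [abs_of_nonneg h1, abs_of_neg h2, abs_of_pos (by omega)]
    omega
  · rw [abs_of_neg h1, abs_of_nonneg h2, abs_of_neg (by omega)]
    omega

theorem cornerTail_eq_zero (hp : p ≠ ∞) {S : Set ℤ} (hS : IsHalfAxis S) {A : L(E)} {k : ℕ}
    (hA : ∀ i j : ℤ, (k : ℤ) ≤ |i - j| → entry A i j = 0) : cornerTail S k A = 0 := by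
  classical
  refine ext_entry hp fun i j => ?_
  rw [cornerTail, entry_sub, finProj, entry_coordProj_mul_mul, corner, entry_coordProj_mul_mul]
  have h0 : entry (0 : L(E)) i j = 0 := rfl
  rw [h0]
  by_cases hij : i ∈ S ∧ j ∈ Sᶜ
  · rw [if_pos hij]
    by_cases hk : (k : ℤ) ≤ |i - j|
    · simp [hA i j hk]
    · obtain ⟨h1, h2⟩ := hS.abs_le hij.1 hij.2
      push Not at hk
      rw [if_pos ⟨h1.trans hk.le, h2.trans hk.le⟩, sub_self]
  · rw [if_neg hij, ite_self, sub_self]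

/-- The corners of the shifted copies of a band-dominated operator are uniformly close to their
finite truncations. -/
theorem exists_norm_cornerTail_shift_le (hp : p ≠ ∞) {S : Set ℤ} (hS : IsHalfAxis S) {A : L(E)}
    (hA : A ∈ bandDominated X p) {ε : ℝ} (hε : 0 < ε) :
    ∃ m, ∀ k, ‖cornerTail S m (shift X p (-k) * A * shift X p k)‖ ≤ ε := by
  obtain ⟨B, ⟨m, hB⟩, hAB⟩ := Metric.mem_closure_iff.1 hA (ε / 2) (half_pos hε)
  rw [dist_eq_norm] at hAB
  refine ⟨m, fun k => ?_⟩
  have h0 : cornerTail S m (shift X p (-k) * B * shift X p k) = 0 := by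
    refine cornerTail_eq_zero hp hS fun i j hij => ?_
    rw [entry_shift_conj]
    exact hB _ _ (by rwa [add_sub_add_right_eq_sub])
  have h1 : cornerTail S m (shift X p (-k) * A * shift X p k) =
      cornerTail S m (shift X p (-k) * (A - B) * shift X p k) := by
    rw [mul_sub, sub_mul, cornerTail_sub, h0, sub_zero]
  rw [h1]
  have h2 := norm_cornerTail_le S m (shift X p (-k) * (A - B) * shift X p k)
  have h3 := norm_shift_conj_le (A - B) k
  linarith

theorem corner_mem_approximable {S : Set ℤ} {A : L(E)}
    (hA : ∀ i j, entry A i j ∈ approximable X)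
    (htail : ∀ ε > 0, ∃ m, ‖cornerTail S m A‖ ≤ ε) :
    corner S A ∈ approximable (SeqSpace X p) := by
  classical
  rw [approximable, ← closure_closure, Metric.mem_closure_iff]
  intro ε hε
  obtain ⟨m, hm⟩ := htail (ε / 2) (half_pos hε)
  refine ⟨finProj X p m * corner S A * finProj X p m,
    finProj_mul_mul_finProj_mem_approximable (fun i j => ?_) m, ?_⟩
  · rw [corner, entry_coordProj_mul_mul]
    split_ifs
    exacts [hA i j, approximable_zero]
  · rw [dist_eq_norm]
    exact hm.trans_lt (half_lt_self hε)

theorem corner_mem_approximable_of_bandDominated (hp : p ≠ ∞) {S : Set ℤ} (hS : IsHalfAxis S)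
    {A : L(E)} (hA : A ∈ bandDominated X p) (hentry : ∀ i j, entry A i j ∈ approximable X) :
    corner S A ∈ approximable (SeqSpace X p) := by
  refine corner_mem_approximable hentry fun ε hε => ?_
  obtain ⟨m, hm⟩ := exists_norm_cornerTail_shift_le hp hS hA hε
  refine ⟨m, ?_⟩
  have := hm 0
  rwa [neg_zero, shift_zero, one_mul, mul_one] at this

theorem IsLimitOperator.corner_mem_approximable (hp : p ≠ ∞) {S : Set ℤ} (hS : IsHalfAxis S)
    {A B : L(E)} {h : ℕ → ℤ} (hB : IsLimitOperator A h B) (hA : A ∈ bandDominated X p)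
    (hentry : ∀ i j, entry A i j ∈ approximable X) :
    corner S B ∈ approximable (SeqSpace X p) := by
  refine BandDominated.corner_mem_approximable (fun i j => ?_) fun ε hε => ?_
  · exact isClosed_closure.mem_of_tendsto (hB.tendsto_entry i j)
      (Eventually.of_forall fun n => hentry _ _)
  · obtain ⟨m, hm⟩ := exists_norm_cornerTail_shift_le hp hS hA hε
    refine ⟨m, norm_le_of_tendsto_apply hε.le (fun x => ?_) fun n => hm (h n)⟩
    have hcorner : ∀ y, Tendsto
        (fun n => corner S (shift X p (-h n) * A * shift X p (h n)) y) atTop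
        (𝓝 (corner S B y)) := fun y =>
      ((coordProj X p S).continuous.tendsto _).comp (hB.tendsto_apply hp (coordProj X p Sᶜ y))
    exact (hcorner x).sub
      (((finProj X p m).continuous.tendsto _).comp (hcorner (finProj X p m x)))

/-- A Fredholm operator with approximable corners has Fredholm compressions to the half-axes. -/
theorem isFredholm_plusPart_and_minusPart [CompleteSpace X] {A : L(E)} (hA : A.IsFredholm)
    (hcorner : ∀ S, IsHalfAxis S → corner S (A - 1) ∈ approximable (SeqSpace X p)) :
    (plusPart A).IsFredholm ∧ (minusPart A).IsFredholm := by
  set P := plusProj X p with hP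
  set Q := minusProj X p with hQ
  have hPQ : P + Q = 1 := add_sub_cancel _ _
  have hPP : P * P = P := by
    rw [hP, plusProj, coordProj_mul_coordProj, Set.inter_self]
  have hPQ0 : P * Q = 0 := by
    rw [hQ, minusProj, mul_sub, mul_one, ← hP, hPP, sub_self]
  have hQP0 : Q * P = 0 := by
    rw [hQ, minusProj, sub_mul, one_mul, ← hP, hPP, sub_self]
  have hQQ : Q * Q = Q := by
    nth_rewrite 1 [hQ, minusProj]
    rw [sub_mul, one_mul, ← hP, hPQ0, sub_zero]
  have c1 : corner {k : ℤ | 0 ≤ k} (A - 1) = P * A * Q := by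
    rw [corner, ← minusProj_eq, ← hQ]
    change P * (A - 1) * Q = _
    rw [mul_sub, mul_one, sub_mul, hPQ0, sub_zero]
  have c2 : corner {k : ℤ | 0 ≤ k}ᶜ (A - 1) = Q * A * P := by
    rw [corner, ← minusProj_eq, ← hQ, compl_compl]
    change Q * (A - 1) * P = _
    rw [mul_sub, mul_one, sub_mul, hQP0, sub_zero]
  have h1 := hcorner _ (Or.inl rfl)
  have h2 := hcorner _ (Or.inr rfl)
  rw [c1] at h1
  rw [c2] at h2
  have hprod : plusPart A * minusPart A = P * A * P + Q * A * Q := by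
    change (P * A * P + Q) * (P + Q * A * Q) = _
    calc (P * A * P + Q) * (P + Q * A * Q)
        = P * A * (P * P) + P * A * (P * Q) * A * Q + Q * P + (Q * Q) * A * Q := by noncomm_ring
      _ = _ := by rw [hPP, hPQ0, hQP0, hQQ]; simp
  have hprod' : minusPart A * plusPart A = P * A * P + Q * A * Q := by
    change (P + Q * A * Q) * (P * A * P + Q) = _
    calc (P + Q * A * Q) * (P * A * P + Q)
        = (P * P) * A * P + P * Q + Q * A * (Q * P) * A * P + Q * A * (Q * Q) := by noncomm_ring
      _ = _ := by rw [hPP, hPQ0, hQP0, hQQ]; simp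
  have hsum : P * A * P + Q * A * Q =
      A + ((P * A * Q).comp (-1 : L(E)) + (Q * A * P).comp (-1 : L(E))) := by
    change _ = A + (P * A * Q * (-1) + Q * A * P * (-1))
    have : A = (P + Q) * A * (P + Q) := by rw [hPQ, one_mul, mul_one]
    calc P * A * P + Q * A * Q
        = (P + Q) * A * (P + Q) + (P * A * Q * (-1) + Q * A * P * (-1)) := by noncomm_ring
      _ = _ := by rw [← this]
  refine isFredholm_of_commute_mul (hprod.trans hprod'.symm) ?_
  rw [hprod, hsum]
  exact isFredholm_add_of_approximable hA (approximable_add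
    (approximable_comp h1 (1 : L(E)) (-1 : L(E))) (approximable_comp h2 (1 : L(E)) (-1 : L(E))))

end Corners

section IndexFormula

variable {X : Type*} [NormedAddCommGroup X] [NormedSpace ℂ X] {p : ℝ≥0∞} [Fact (1 ≤ p)]

local notation "L(E)" => SeqSpace X p →L[ℂ] SeqSpace X p

theorem isFredholm_parts_of_mem_fredholmOperators [CompleteSpace X] (hX : HasSAP X)
    (hp : p ≠ ∞) {A : L(E)} (hA : A ∈ fredholmOperators X p) :
    (plusPart A).IsFredholm ∧ (minusPart A).IsFredholm := by
  obtain ⟨hfred, K, ⟨hK, hcomp, -⟩, rfl⟩ := hA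
  refine isFredholm_plusPart_and_minusPart hfred fun S hS => ?_
  rw [add_sub_cancel_left]
  exact corner_mem_approximable_of_bandDominated hp hS hK fun i j =>
    mem_approximable_of_isCompactOperator hX (hcomp i j)

theorem IsLimitOperator.isFredholm_parts [CompleteSpace X] (hX : HasSAP X) (hp1 : 1 < p)
    (hp : p ≠ ∞) {A B : L(E)} (hA : A ∈ fredholmOperators X p) {h : ℕ → ℤ}
    (hh : Tendsto (fun n => |h n|) atTop atTop) (hB : IsLimitOperator A h B) :
    (plusPart B).IsFredholm ∧ (minusPart B).IsFredholm := by
  have hbij := hB.bijective_of_isFredholm hp1 hp hh hA.1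
  obtain ⟨-, K, ⟨hK, hcomp, -⟩, rfl⟩ := hA
  refine isFredholm_plusPart_and_minusPart (isFredholm_of_bijective hbij) fun S hS => ?_
  have hB' := hB.sub (isLimitOperator_one h)
  rw [add_sub_cancel_left] at hB'
  exact hB'.corner_mem_approximable hp hS hK fun i j =>
    mem_approximable_of_isCompactOperator hX (hcomp i j)

theorem continuous_plusPart : Continuous (plusPart : L(E) → L(E)) := by
  unfold plusPart
  fun_prop

theorem continuous_minusPart : Continuous (minusPart : L(E) → L(E)) := by
  unfold minusPart
  fun_prop

theorem eventually_indPlus_eq [CompleteSpace X] {A : L(E)} (hA : (plusPart A).IsFredholm) :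
    ∀ᶠ B in 𝓝 A, indPlus B = indPlus A :=
  (continuous_plusPart.tendsto A).eventually
    ((eventually_fredholmIndex_eq hA).mono fun _ h => h.2)

theorem eventually_indMinus_eq [CompleteSpace X] {A : L(E)} (hA : (minusPart A).IsFredholm) :
    ∀ᶠ B in 𝓝 A, indMinus B = indMinus A :=
  (continuous_minusPart.tendsto A).eventually
    ((eventually_fredholmIndex_eq hA).mono fun _ h => h.2)

/-- A limit operator of `A` has a nearby limit operator of every nearby operator `A'`, with respect
to a subsequence. -/
theorem IsLimitOperator.exists_isLimitOperator_norm_sub_le (hp : p ≠ ∞) {A A' B : L(E)}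
    (hA' : A' ∈ fredholmOperators X p) {h : ℕ → ℤ}
    (hh : Tendsto (fun n => |h n|) atTop atTop) (hB : IsLimitOperator A h B) :
    ∃ φ : ℕ → ℕ, StrictMono φ ∧ ∃ B', IsLimitOperator A' (h ∘ φ) B' ∧ ‖B' - B‖ ≤ ‖A' - A‖ := by
  obtain ⟨-, K, ⟨-, -, hrich⟩, rfl⟩ := hA'
  obtain ⟨φ, hφ, L, hL⟩ := hrich h hh
  have hL' : IsLimitOperator (1 + K) (h ∘ φ) (1 + L) := by
    intro k
    have e : ∀ n, shift X p (-(h ∘ φ) n) * (1 + K) * shift X p ((h ∘ φ) n) - (1 + L) =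
        shift X p (-(h ∘ φ) n) * K * shift X p ((h ∘ φ) n) - L := by
      intro n
      rw [mul_add, add_mul, mul_one, shift_neg_mul_shift]
      abel
    simp only [e]
    exact hL k
  exact ⟨φ, hφ, 1 + L, hL', (hL'.sub (hB.comp_strictMono hφ)).norm_le hp⟩

end IndexFormula

end BandDominated

theorem proposition21 (X : Type*) [NormedAddCommGroup X] [NormedSpace ℂ X] [CompleteSpace X]
    (hX : BandDominated.HasSAP X) (p : ℝ≥0∞) [Fact (1 ≤ p)] (hp1 : 1 < p) (hp2 : p < ∞)
    (F : Set (BandDominated.SeqSpace X p →L[ℂ] BandDominated.SeqSpace X p))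
    (hF : F ⊆ BandDominated.fredholmOperators X p)
    (hdense : BandDominated.fredholmOperators X p ⊆ closure F)
    (hformula : ∀ A ∈ F, BandDominated.IndexFormula A) :
    ∀ A ∈ BandDominated.fredholmOperators X p,
      BandDominated.IndicesDefined A ∧ BandDominated.IndexFormula A := by
  intro A hA
  have hp := hp2.ne
  obtain ⟨hA1, hA2⟩ := BandDominated.isFredholm_parts_of_mem_fredholmOperators hX hp hA
  refine ⟨⟨hA1, hA2, ?_, ?_⟩, ?_⟩
  · rintro B ⟨h, hh, hB⟩
    exact (hB.isFredholm_parts hX hp1 hp hA (tendsto_abs_atTop_atTop.comp hh)).1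
  · rintro B ⟨h, hh, hB⟩
    exact (hB.isFredholm_parts hX hp1 hp hA (tendsto_abs_atBot_atTop.comp hh)).2
  rintro Bp ⟨h, hh, hBp⟩ Bm ⟨g, hg, hBm⟩
  have hh' : Tendsto (fun n => |h n|) atTop atTop := tendsto_abs_atTop_atTop.comp hh
  have hg' : Tendsto (fun n => |g n|) atTop atTop := tendsto_abs_atBot_atTop.comp hg
  obtain ⟨r, hr, hrBp⟩ := Metric.eventually_nhds_iff.1
    (BandDominated.eventually_indPlus_eq (hBp.isFredholm_parts hX hp1 hp hA hh').1)
  obtain ⟨s, hs, hsBm⟩ := Metric.eventually_nhds_iff.1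
    (BandDominated.eventually_indMinus_eq (hBm.isFredholm_parts hX hp1 hp hA hg').2)
  have hball : ∀ᶠ C in 𝓝 A, C ∈ Metric.ball A (min r s) :=
    Metric.ball_mem_nhds A (lt_min hr hs)
  obtain ⟨A', hA'F, h1, ⟨-, h2⟩, h3, h4⟩ :=
    ((mem_closure_iff_frequently.1 (hdense hA)).and_eventually
      ((BandDominated.eventually_indPlus_eq hA1).and
        ((BandDominated.eventually_fredholmIndex_eq hA.1).and
          ((BandDominated.eventually_indMinus_eq hA2).and hball)))).exists
  rw [mem_ball_iff_norm, lt_min_iff] at h4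
  obtain ⟨φ, hφ, Bp', hBp', hBp'n⟩ :=
    hBp.exists_isLimitOperator_norm_sub_le hp (hF hA'F) hh'
  obtain ⟨ψ, hψ, Bm', hBm', hBm'n⟩ :=
    hBm.exists_isLimitOperator_norm_sub_le hp (hF hA'F) hg'
  obtain ⟨⟨k1, k2⟩, k3⟩ := hformula A' hA'F Bp' ⟨h ∘ φ, hh.comp hφ.tendsto_atTop, hBp'⟩
    Bm' ⟨g ∘ ψ, hg.comp hψ.tendsto_atTop, hBm'⟩
  have k4 := hrBp (y := Bp') (by rw [dist_eq_norm]; exact hBp'n.trans_lt h4.1)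
  have k5 := hsBm (y := Bm') (by rw [dist_eq_norm]; exact hBm'n.trans_lt h4.2)
  rw [k4, h1] at k1
  rw [k5, h3] at k2
  rw [h2, k4, k5] at k3
  exact ⟨⟨k1, k2⟩, k3⟩
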